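/- Let $n \ge 4$. The Hamiltonian Path game on $K_n$ is played on the edge set $E(K_n)$ of the complete graph on $n$ vertices: two players, Maker and Breaker, alternately claim one previously unclaimed edge at a time, until all edges are claimed. Maker wins if the edges he has claimed contain the edge set of a Hamiltonian path of $K_n$; otherwise Breaker wins. Then Maker has a winning strategy as the first player if and only if $n \ge 5$, and Maker has a winning strategy as the second player if and only if $n \ge 5$. -/

import Mathlib

namespace MakerBreaker

/-- A positional game on the finite board `X`: a hypergraph whose vertices are the elements of `X` and
whose hyperedges are the winning sets. -/
structure PositionalGame (X : Type*) [Finite X] where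
  winningSets : Set (Set X)

/-- The two seats in a game: the player who moves first and the player who moves second. -/
inductive Seat where
  | first
  | second

/-- Moves are numbered from `0`; the first player makes the moves with even number, the second
player those with odd number. -/
def Seat.MovesAt : Seat → ℕ → Prop
  | Seat.first, i => Even i
  | Seat.second, i => Odd i

/-- A complete play lists all elements of the board in the order in which they are claimed, each
exactly once. -/
def IsCompletePlay {X : Type*} (p : List X) : Prop :=
  p.Nodup ∧ ∀ x, x ∈ p

/-- The elements that the player in seat `s` claims in the course of the play `p`. -/
def claimed {X : Type*} (s : Seat) (p : List X) : Set X :=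
  {x | ∃ i, s.MovesAt i ∧ p[i]? = some x}

/-- A strategy assigns to the list of all moves made so far (by both players) the next element to
claim. It only ever claims unclaimed elements, and it does provide a move as long as some
element is unclaimed. -/
structure Strategy (X : Type*) where
  move : List X → Option X
  notMem_of_move : ∀ h x, move h = some x → x ∉ h
  exists_move : ∀ h, (∃ x, x ∉ h) → ∃ x, move h = some x

/-- In the play `p`, the player in seat `s` makes all of his moves according to `σ`. -/
def Strategy.Follows {X : Type*} (σ : Strategy X) (s : Seat) (p : List X) : Prop :=
  ∀ i, i < p.length → s.MovesAt i → p[i]? = σ.move (p.take i)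

/-- Maker, playing from seat `s`, wins the Maker-Breaker game `G`: he has a strategy such that,
in every complete play in which he follows it, he claims all elements of a winning set. -/
def MakerWins {X : Type*} [Finite X] (G : PositionalGame X) (s : Seat) : Prop :=
  ∃ σ : Strategy X, ∀ p : List X, IsCompletePlay p → σ.Follows s p →
    ∃ F ∈ G.winningSets, F ⊆ claimed s p

/-- The Hamiltonian Path game: the board is the edge set of the complete graph on `n` vertices,
the winning sets are the edge sets of all Hamiltonian paths in it. -/
def hamiltonianPathGame (n : ℕ) :
    PositionalGame (SimpleGraph.completeGraph (Fin n)).edgeSet where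
  winningSets := {F | ∃ (u v : Fin n) (w : (SimpleGraph.completeGraph (Fin n)).Walk u v),
    w.IsHamiltonian ∧ F = {e | (e : Sym2 (Fin n)) ∈ w.edges}}

end MakerBreaker

/-! For `n = 4`, the six edges of `K_4` split into three pairs of disjoint edges, and the first and
third edges of a Hamiltonian path form such a pair. Breaker answers each edge with its partner
(`not_makerWins_of_pairing`).

For `n ≥ 5`, it suffices that Maker wins when Breaker starts (`makerWins_of_winsFrom`), an extra
Maker move being harmless. Maker grows a path whose set `U` of missing vertices contains no Breaker
edge, with one end joined to `U` by no Breaker edge and the other by at most one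
(`winsFrom_of_path`). When three vertices are missing, he claims an edge among them, then attaches
the last vertex to a path end so that two disjoint paths remain with at least two of the four
joining edges free: a double threat (`winsFrom_of_three_paths`, `winsFrom_of_two_paths`). -/

namespace MakerBreaker

/-! ### Winning positions, independently of strategies and plays -/

/-- `WinsFrom D H M B`: with Breaker to move, Maker owning `M` and Breaker owning `B`, Maker can reach
a position satisfying `H` by claiming elements of `D`. Breaker is allowed arbitrary moves. -/
inductive WinsFrom {E : Type*} (D : Set E) (H : Set E → Prop) : Set E → Set E → Prop
  | done {M B : Set E} (h : H M) : WinsFrom D H M B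
  | reply {M B : Set E} (f : E → E) (hD : ∀ e, f e ∈ D) (hB : ∀ e, f e ∉ insert e B)
      (h : ∀ e, WinsFrom D H (insert (f e) M) (insert e B)) : WinsFrom D H M B

namespace WinsFrom

variable {E : Type*} {D : Set E} {H : Set E → Prop}

theorem step {M B : Set E}
    (h : ∀ e, ∃ f ∈ D, f ∉ insert e B ∧ WinsFrom D H (insert f M) (insert e B)) :
    WinsFrom D H M B := by
  choose f hD hB h using h
  exact .reply f hD hB h

theorem mono (hH : ∀ M M', M ⊆ M' → H M → H M') {M B : Set E} (h : WinsFrom D H M B) :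
    ∀ {M' B' : Set E}, M ⊆ M' → B' ⊆ B → WinsFrom D H M' B' := by
  induction h with
  | done h => exact fun hM _ => .done (hH _ _ hM h)
  | reply f hD hB _ ih =>
    exact fun hM hB' => .reply f hD (fun e he => hB e (Set.insert_subset_insert hB' he))
      fun e => ih e (Set.insert_subset_insert hM) (Set.insert_subset_insert hB')

theorem exists_reply {M B : Set E} (h : WinsFrom D H M B) (e : E) :
    H M ∨ ∃ f ∈ D, f ∉ insert e B ∧ WinsFrom D H (insert f M) (insert e B) := by
  cases h with
  | done h => exact .inl h
  | reply f hD hB h => exact .inr ⟨f e, hD e, hB e, h e⟩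

/-- If no element of the board is free, a won position satisfies the goal. -/
theorem of_full [Inhabited E] {M B : Set E} (h : WinsFrom D H M B) (hD : D ⊆ M ∪ B) : H M := by
  induction h with
  | done h => exact h
  | @reply M B f hfD hfB _ ih =>
    -- On a full board the reply can only be an element Maker already owns, so `M` does not change.
    have hf : f default ∈ M :=
      (hD (hfD _)).resolve_right fun h => hfB _ (Set.mem_insert_of_mem _ h)
    have := ih default
    rw [Set.insert_eq_of_mem hf] at this
    exact this (hD.trans (Set.union_subset_union_right _ (Set.subset_insert _ _)))

/-- Two distinct free elements, each of which completes Maker's goal, decide the game. -/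
theorem of_two_threats {M B : Set E} {e₁ e₂ : E} (hne : e₁ ≠ e₂) (h₁ : e₁ ∈ D) (h₂ : e₂ ∈ D)
    (hB₁ : e₁ ∉ B) (hB₂ : e₂ ∉ B) (hH₁ : H (insert e₁ M)) (hH₂ : H (insert e₂ M)) :
    WinsFrom D H M B := by
  refine .step fun e => ?_
  by_cases he : e₁ = e
  · exact ⟨e₂, h₂, by grind, .done hH₂⟩
  · exact ⟨e₁, h₁, by grind, .done hH₁⟩

end WinsFrom

/-! ### Seats, strategies and complete plays -/

/-- The opponent's seat. -/
def Seat.other : Seat → Seat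
  | .first => .second
  | .second => .first

theorem Seat.movesAt_other (s : Seat) (i : ℕ) : s.other.MovesAt i ↔ ¬ s.MovesAt i := by
  cases s <;> simp [Seat.other, Seat.MovesAt]

theorem Seat.movesAt_succ (s : Seat) (i : ℕ) : s.MovesAt (i + 1) ↔ ¬ s.MovesAt i := by
  cases s <;> simp [Seat.MovesAt, Nat.even_add_one, Nat.odd_add_one]

section

variable {X : Type*}

theorem claimed_nil (s : Seat) : claimed s ([] : List X) = ∅ := by
  ext; simp [claimed]

theorem claimed_append_singleton_of_movesAt {s : Seat} {h : List X} (hs : s.MovesAt h.length)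
    (x : X) : claimed s (h ++ [x]) = insert x (claimed s h) := by
  ext y
  simp only [claimed, Set.mem_ofPred_eq, Set.mem_insert_iff]
  grind

theorem claimed_append_singleton_of_not_movesAt {s : Seat} {h : List X}
    (hs : ¬ s.MovesAt h.length) (x : X) : claimed s (h ++ [x]) = claimed s h := by
  ext y
  simp only [claimed, Set.mem_ofPred_eq]
  grind

theorem mem_claimed_or {h : List X} {x : X} (hx : x ∈ h) (s : Seat) :
    x ∈ claimed s h ∨ x ∈ claimed s.other h := by
  obtain ⟨i, hi⟩ := List.mem_iff_getElem?.1 hx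
  by_cases hs : s.MovesAt i
  · exact .inl ⟨i, hs, hi⟩
  · exact .inr ⟨i, (s.movesAt_other i).2 hs, hi⟩

open Classical in
/-- The strategy that claims a free element satisfying `P` if there is one, and an arbitrary free
element otherwise. -/
noncomputable def Strategy.preferring (P : List X → X → Prop) : Strategy X where
  move h :=
    if hP : ∃ x, x ∉ h ∧ P h x then some hP.choose
    else if hx : ∃ x, x ∉ h then some hx.choose
    else none
  notMem_of_move h x hx := by
    split_ifs at hx with h₁ h₂
    · obtain rfl := Option.some.inj hx
      exact h₁.choose_spec.1
    · obtain rfl := Option.some.inj hx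
      exact h₂.choose_spec
  exists_move h hx := by
    split_ifs
    exacts [⟨_, rfl⟩, ⟨_, rfl⟩]

theorem Strategy.preferring_spec {P : List X → X → Prop} {h : List X} {x : X}
    (hx : (preferring P).move h = some x) (hP : ∃ x, x ∉ h ∧ P h x) : P h x := by
  simp only [preferring, hP, dite_true, Option.some.injEq] at hx
  exact hx ▸ hP.choose_spec.2

/-- Any two strategies can be played against each other. -/
theorem exists_isCompletePlay [Finite X] (σ τ : Strategy X) (s : Seat) :
    ∃ p : List X, IsCompletePlay p ∧ σ.Follows s p ∧ τ.Follows s.other p := by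
  classical
  have := Fintype.ofFinite X
  have key : ∀ k ≤ Fintype.card X, ∃ p : List X, p.length = k ∧ p.Nodup ∧ σ.Follows s p ∧
      τ.Follows s.other p := by
    intro k
    induction k with
    | zero => exact fun _ => ⟨[], by simp [Strategy.Follows]⟩
    | succ k ih =>
      intro hk
      obtain ⟨p, hp, hnd, hσ, hτ⟩ := ih (by omega)
      have hfree : ∃ x, x ∉ p := by
        by_contra! hall
        have := Finset.card_le_card (show Finset.univ ⊆ p.toFinset from fun x _ => by simp [hall x])
        have := p.toFinset_card_le
        rw [Finset.card_univ] at *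
        omega
      obtain ⟨x, hxσ⟩ := σ.exists_move p hfree
      obtain ⟨y, hyτ⟩ := τ.exists_move p hfree
      have hxp := σ.notMem_of_move _ _ hxσ
      have hyp := τ.notMem_of_move _ _ hyτ
      have ext : ∀ (ρ : Strategy X) (t : Seat) (z : X), ρ.Follows t p →
          (t.MovesAt k → ρ.move p = some z) → ρ.Follows t (p ++ [z]) := by
        intro ρ t z hρ hz i hi ht
        rcases Nat.lt_or_ge i k with hik | hik
        · rw [List.getElem?_append_left (by omega), List.take_append_of_le_length (by omega)]
          exact hρ i (by omega) ht
        · obtain rfl : i = k := by simp at hi; omega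
          rw [← hp, List.take_left', hz ht]
          · simp
          · rfl
      by_cases hs : s.MovesAt k
      · refine ⟨p ++ [x], by simp [hp], by simp [List.nodup_append, hnd]; grind,
          ext σ s x hσ fun _ => hxσ, ext τ _ x hτ fun h => ?_⟩
        exact absurd hs ((s.movesAt_other k).1 h)
      · exact ⟨p ++ [y], by simp [hp], by simp [List.nodup_append, hnd]; grind,
          ext σ s y hσ fun h => absurd h hs, ext τ _ y hτ fun _ => hyτ⟩
  obtain ⟨p, hp, hnd, hσ, hτ⟩ := key _ le_rfl
  refine ⟨p, ⟨hnd, fun x => ?_⟩, hσ, hτ⟩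
  rw [← List.mem_toFinset, Finset.eq_univ_of_card p.toFinset
    (by rw [List.toFinset_card_of_nodup hnd, hp])]
  exact Finset.mem_univ x

end

/-- If Maker wins from the empty position with Breaker to move, then he wins from either seat. -/
theorem makerWins_of_winsFrom {E : Type*} [Inhabited E] {D : Set E} [Finite D]
    (G : PositionalGame D) {H : Set E → Prop} (hH : ∀ M M', M ⊆ M' → H M → H M')
    (hG : ∀ N : Set D, H (Subtype.val '' N) → ∃ F ∈ G.winningSets, F ⊆ N)
    (h : WinsFrom D H ∅ ∅) (s : Seat) : MakerWins G s := by
  let c (t : Seat) (p : List D) : Set E := Subtype.val '' claimed t p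
  refine ⟨.preferring fun p x => WinsFrom D H (insert x.1 (c s p)) (c s.other p), ?_⟩
  intro p hp hσ
  have key : ∀ k ≤ p.length,
      (s.MovesAt k → H (c s (p.take k)) ∨ ∃ f ∈ D, f ∉ c s.other (p.take k) ∧
        WinsFrom D H (insert f (c s (p.take k))) (c s.other (p.take k))) ∧
      (¬ s.MovesAt k → WinsFrom D H (c s (p.take k)) (c s.other (p.take k))) := by
    intro k
    induction k with
    | zero =>
      refine fun _ => ⟨fun _ => ?_, fun _ => by simpa [c, claimed_nil] using h⟩
      simp only [c, List.take_zero, claimed_nil, Set.image_empty]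
      -- Moving first, Maker answers an imaginary Breaker move at `default`; forgetting it
      -- afterwards only helps him.
      exact (h.exists_reply default).imp_right fun ⟨f, hfD, _, hw⟩ =>
        ⟨f, hfD, Set.notMem_empty f, hw.mono hH subset_rfl (Set.empty_subset _)⟩
    | succ k ih =>
      intro hk
      obtain ⟨ih₁, ih₂⟩ := ih (by omega)
      have hlen : (p.take k).length = k := by simp; omega
      have htake : p.take (k + 1) = p.take k ++ [p[k]] := by simp
      by_cases hs : s.MovesAt k
      · have hs' : ¬ s.other.MovesAt k := by simpa [s.movesAt_other] using hs
        refine ⟨fun h' => absurd hs ((s.movesAt_succ k).1 h'), fun _ => ?_⟩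
        rw [htake]
        simp only [c]
        rw [claimed_append_singleton_of_movesAt (by rwa [hlen]),
          claimed_append_singleton_of_not_movesAt (by rwa [hlen]), Set.image_insert_eq]
        rcases ih₁ hs with hend | ⟨f, hfD, hfB, hw⟩
        · exact .done (hH _ _ (Set.subset_insert _ _) hend)
        -- The prescribed reply may already be Maker's; then any move will do, by monotonicity.
        by_cases hfM : f ∈ c s (p.take k)
        · rw [Set.insert_eq_of_mem hfM] at hw
          exact hw.mono hH (Set.subset_insert _ _) subset_rfl
        · have hmove := hσ k (by omega) hs
          rw [List.getElem?_eq_getElem (by omega)] at hmove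
          refine Strategy.preferring_spec hmove.symm ⟨⟨f, hfD⟩, fun hf => ?_, hw⟩
          rcases mem_claimed_or hf s with h' | h'
          exacts [hfM ⟨_, h', rfl⟩, hfB ⟨_, h', rfl⟩]
      · have hs' : s.other.MovesAt k := by simpa [s.movesAt_other] using hs
        refine ⟨fun _ => ?_, fun h' => absurd ((s.movesAt_succ k).2 hs) h'⟩
        rw [htake]
        simp only [c]
        rw [claimed_append_singleton_of_not_movesAt (by rwa [hlen]),
          claimed_append_singleton_of_movesAt (by rwa [hlen]), Set.image_insert_eq]
        exact (ih₂ hs).exists_reply _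
  have hfull : D ⊆ c s p ∪ c s.other p := by
    intro e he
    rcases mem_claimed_or (hp.2 ⟨e, he⟩) s with h | h
    exacts [.inl ⟨_, h, rfl⟩, .inr ⟨_, h, rfl⟩]
  apply hG
  have hend := key p.length le_rfl
  rw [List.take_length] at hend
  by_cases hs : s.MovesAt p.length
  · rcases hend.1 hs with hend | ⟨f, hfD, hfB, hw⟩
    · exact hend
    · rw [Set.insert_eq_of_mem ((hfull hfD).resolve_right hfB)] at hw
      exact hw.of_full hfull
  · exact (hend.2 hs).of_full hfull

/-- If every winning set contains two elements paired with each other by the matching `R`, the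
player who always answers in the pairing prevents Maker from winning. -/
theorem not_makerWins_of_pairing {X : Type*} [Finite X] (G : PositionalGame X) (R : X → X → Prop)
    (hR : ∀ x y z, R x y → R x z → y = z) (hsymm : ∀ x y, R x y → R y x) (hirr : ∀ x, ¬ R x x)
    (hG : ∀ F ∈ G.winningSets, ∃ x ∈ F, ∃ y ∈ F, R x y) (s : Seat) : ¬ MakerWins G s := by
  rintro ⟨σ, hσ⟩
  obtain ⟨p, hp, hpσ, hpτ⟩ := exists_isCompletePlay σ
    (.preferring fun h y => ∃ x, h.getLast? = some x ∧ R x y) s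
  obtain ⟨F, hF, hFs⟩ := hσ p hp hpσ
  obtain ⟨x, hx, y, hy, hxy⟩ := hG F hF
  -- At move `i + 1` the partner `y` was still free, so Breaker took it then and Maker cannot get it
  -- at move `j`.
  have key : ∀ i j x y, i < j → s.MovesAt i → s.MovesAt j → p[i]? = some x → p[j]? = some y →
      R x y → False := by
    intro i j x y hij hi hj hx hy hxy
    have hi' : s.other.MovesAt (i + 1) := by simpa [s.movesAt_other, s.movesAt_succ] using hi
    have hne : i + 1 ≠ j := by
      rintro rfl
      exact (s.movesAt_succ i).1 hj hi
    have hjl : j < p.length := by grind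
    obtain ⟨z, hz⟩ : ∃ z, p[i + 1]? = some z := ⟨_, List.getElem?_eq_getElem (by omega)⟩
    have hmove := hpτ (i + 1) (by omega) hi'
    rw [hz] at hmove
    have hlast : (p.take (i + 1)).getLast? = some x := by
      grind
    have hyp : y ∉ p.take (i + 1) := by
      intro hmem
      obtain ⟨k, hk, hk'⟩ := List.mem_take_iff_getElem.1 hmem
      have := (List.Nodup.getElem_inj_iff hp.1 (i := k) (j := j) (hi := by omega) (hj := hjl)).1
        (by grind)
      omega
    obtain ⟨x', hx', hR'⟩ := Strategy.preferring_spec hmove.symm ⟨y, hyp, x, hlast, hxy⟩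
    rw [hlast] at hx'
    obtain rfl := Option.some.inj hx'
    obtain rfl := hR _ _ _ hR' hxy
    have := (List.Nodup.getElem_inj_iff hp.1 (i := i + 1) (j := j) (hi := by omega) (hj := hjl)).1
      (by grind)
    omega
  obtain ⟨i, hi, hxi⟩ := hFs hx
  obtain ⟨j, hj, hyj⟩ := hFs hy
  rcases lt_trichotomy i j with hij | rfl | hij
  · exact key i j x y hij hi hj hxi hyj hxy
  · obtain rfl : x = y := by simpa using hxi.symm.trans hyj
    exact hirr x hxy
  · exact key j i y x hij hj hi hyj hxi (hsymm _ _ hxy)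

/-! ### Four vertices: Breaker's pairing -/

theorem exists_disjoint_edges_of_isHamiltonian {u v : Fin 4}
    {w : (SimpleGraph.completeGraph (Fin 4)).Walk u v} (hw : w.IsHamiltonian) :
    ∃ e ∈ w.edges, ∃ f ∈ w.edges, ∀ a, a ∈ e → a ∉ f := by
  have hlen := hw.length_eq
  have hnd := hw.isPath.support_nodup
  rcases w with _ | ⟨h₁, _ | ⟨h₂, _ | ⟨h₃, _ | ⟨h₄, w⟩⟩⟩⟩ <;>
    simp only [SimpleGraph.Walk.length_nil, SimpleGraph.Walk.length_cons, Fintype.card_fin] at hlen <;>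
    try omega
  simp only [SimpleGraph.Walk.support_cons, SimpleGraph.Walk.support_nil] at hnd
  refine ⟨_, List.mem_cons_self, _,
    List.mem_cons_of_mem _ (List.mem_cons_of_mem _ List.mem_cons_self), ?_⟩
  intro a
  simp only [SimpleGraph.Dart.edge_mk, Sym2.mem_iff]
  grind

theorem not_makerWins_hamiltonianPathGame_four (s : Seat) :
    ¬ MakerWins (hamiltonianPathGame 4) s := by
  refine not_makerWins_of_pairing _ (fun x y => ∀ a, a ∈ x.1 → a ∉ y.1) ?_ ?_ ?_ ?_ s
  · rintro ⟨x, hx⟩ ⟨y, hy⟩ ⟨z, hz⟩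
    induction x with | _ a b
    induction y with | _ c d
    induction z with | _ e f
    simp only [SimpleGraph.completeGraph, SimpleGraph.mem_edgeSet, SimpleGraph.top_adj] at hx hy hz
    simp only [Sym2.mem_iff, Subtype.mk.injEq, Sym2.eq_iff, forall_eq_or_imp, forall_eq]
    omega
  · exact fun x y h a hy hx => h a hx hy
  · rintro ⟨x, hx⟩ h
    induction x with | _ a b
    exact h a (Sym2.mem_mk_left a b) (Sym2.mem_mk_left a b)
  · rintro F ⟨u, v, w, hw, hF⟩
    obtain ⟨e, he, f, hf, hef⟩ := exists_disjoint_edges_of_isHamiltonian hw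
    have mem : ∀ e ∈ w.edges, ∃ x ∈ F, x.1 = e := fun e he => by
      have : e ∈ Subtype.val '' F := hF ▸ he
      simpa using this
    obtain ⟨x, hx, rfl⟩ := mem e he
    obtain ⟨y, hy, rfl⟩ := mem f hf
    exact ⟨x, hx, y, hy, hef⟩

/-! ### Paths in Maker's graph and the endgame -/

section

variable {V : Type*}

/-- The edges in `M` contain a path from `a` to `b` whose vertex set is `S`. -/
def HasPathOn (M : Set (Sym2 V)) (S : Set V) (a b : V) : Prop :=
  ∃ l : List V, l.Nodup ∧ l.IsChain (fun u v => s(u, v) ∈ M) ∧ (∀ v, v ∈ l ↔ v ∈ S) ∧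
    l.head? = some a ∧ l.getLast? = some b

namespace HasPathOn

variable {M M' : Set (Sym2 V)} {S T : Set V} {a b c d : V}

theorem mono (h : HasPathOn M S a b) (hM : M ⊆ M') : HasPathOn M' S a b := by
  obtain ⟨l, h₁, h₂, h₃⟩ := h
  exact ⟨l, h₁, h₂.imp fun _ _ h => hM h, h₃⟩

theorem symm (h : HasPathOn M S a b) : HasPathOn M S b a := by
  obtain ⟨l, h₁, h₂, h₃, h₄, h₅⟩ := h
  refine ⟨l.reverse, List.nodup_reverse.2 h₁, ?_, by simpa using h₃, by simpa using h₅,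
    by simpa using h₄⟩
  rw [List.isChain_reverse]
  exact h₂.imp fun _ _ h => by rwa [Sym2.eq_swap]

theorem singleton (M : Set (Sym2 V)) (a : V) : HasPathOn M {a} a a :=
  ⟨[a], by simp⟩

theorem join (h : HasPathOn M S a b) (h' : HasPathOn M T c d) (hST : Disjoint S T)
    (hbc : s(b, c) ∈ M) : HasPathOn M (S ∪ T) a d := by
  obtain ⟨l, h₁, h₂, h₃, h₄, h₅⟩ := h
  obtain ⟨l', h₁', h₂', h₃', h₄', h₅'⟩ := h'
  refine ⟨l ++ l', ?_, ?_, ?_, ?_, ?_⟩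
  · refine List.nodup_append'.2 ⟨h₁, h₁', fun v hv hv' => ?_⟩
    exact Set.disjoint_left.1 hST ((h₃ v).1 hv) ((h₃' v).1 hv')
  · refine List.isChain_append.2 ⟨h₂, h₂', ?_⟩
    simp [h₅, h₄', hbc]
  · simp [h₃, h₃']
  · simp [List.head?_append, h₄]
  · simp [List.getLast?_append, h₅']

theorem left_mem (h : HasPathOn M S a b) : a ∈ S := by
  obtain ⟨l, -, -, h₃, h₄, -⟩ := h
  exact (h₃ a).1 (List.mem_of_head? h₄)

theorem right_mem (h : HasPathOn M S a b) : b ∈ S := h.symm.left_mem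

end HasPathOn

/-- The edges in `M` contain a Hamiltonian path. -/
def HasHamiltonianPath (M : Set (Sym2 V)) : Prop := ∃ a b, HasPathOn M Set.univ a b

theorem HasHamiltonianPath.mono (M M' : Set (Sym2 V)) (hM : M ⊆ M') (h : HasHamiltonianPath M) :
    HasHamiltonianPath M' := by
  obtain ⟨a, b, h⟩ := h
  exact ⟨a, b, h.mono hM⟩

/-- The edges of the complete graph. -/
abbrev nonDiag (V : Type*) : Set (Sym2 V) := {e | ¬ e.IsDiag}

open Classical in
/-- With two paths covering all vertices, Maker wins if Breaker owns at most two of the four edges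
that join their ends. -/
theorem winsFrom_of_two_paths {M B : Set (Sym2 V)} {S T : Set V} {a b c d : V}
    (h : HasPathOn M S a b) (h' : HasPathOn M T c d) (hST : Disjoint S T) (hun : S ∪ T = Set.univ)
    (hab : a ≠ b) (hcd : c ≠ d)
    (hB : [s(a, c), s(a, d), s(b, c), s(b, d)].countP (· ∈ B) ≤ 2) :
    WinsFrom (nonDiag V) HasHamiltonianPath M B := by
  have key : ∀ e ∈ [s(a, c), s(a, d), s(b, c), s(b, d)],
      e ∈ nonDiag V ∧ HasHamiltonianPath (insert e M) := by
    have main : ∀ {a b c d}, HasPathOn M S a b → HasPathOn M T c d →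
        s(b, c) ∈ nonDiag V ∧ HasHamiltonianPath (insert s(b, c) M) := by
      intro a b c d h h'
      refine ⟨?_, a, d, ?_⟩
      · rintro (rfl : b = c)
        exact Set.disjoint_left.1 hST h.right_mem h'.left_mem
      · rw [← hun]
        exact (h.mono (Set.subset_insert _ _)).join (h'.mono (Set.subset_insert _ _)) hST
          (Set.mem_insert _ _)
    simpa using ⟨main h.symm h', main h.symm h'.symm, main h h', main h h'.symm⟩
  have hne : ∀ {x y}, x ∈ S → y ∈ T → x ≠ y := fun hx hy hxy =>
    Set.disjoint_left.1 hST hx (hxy ▸ hy)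
  have hac := hne h.left_mem h'.left_mem
  have had := hne h.left_mem h'.right_mem
  have hbc := hne h.right_mem h'.left_mem
  have hbd := hne h.right_mem h'.right_mem
  set L := [s(a, c), s(a, d), s(b, c), s(b, d)] with hL
  have hnd : L.Nodup := by
    simp [hL]
    grind
  obtain ⟨e₁, he₁, e₂, he₂, hne', hB₁, hB₂⟩ :
      ∃ e₁ ∈ L, ∃ e₂ ∈ L, e₁ ≠ e₂ ∧ e₁ ∉ B ∧ e₂ ∉ B := by
    have hlen : 2 ≤ (L.filter (· ∉ B)).length := by
      have := L.length_eq_countP_add_countP (· ∈ B)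
      rw [← List.countP_eq_length_filter]
      simp only [hL, List.length_cons, List.length_nil] at this hB ⊢
      simp only [decide_not] at *
      grind
    have hnd' := hnd.filter (· ∉ B)
    have hmem : ∀ e ∈ L.filter (· ∉ B), e ∈ L ∧ e ∉ B := by simp
    match L.filter (· ∉ B), hlen, hnd', hmem with
    | e₁ :: e₂ :: _, _, hnd', hmem =>
      exact ⟨e₁, (hmem e₁ (by simp)).1, e₂, (hmem e₂ (by simp)).1, by grind,
        (hmem e₁ (by simp)).2, (hmem e₂ (by simp)).2⟩
  exact .of_two_threats hne' (key _ he₁).1 (key _ he₂).1 hB₁ hB₂ (key _ he₁).2 (key _ he₂).2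

open Classical in
/-- With a path, a second path and a single vertex covering all vertices, and Breaker owning at most
two of the edges between their ends, Maker wins. -/
theorem winsFrom_of_three_paths {M B : Set (Sym2 V)} {S T : Set V} {a b p q t : V}
    (h : HasPathOn M S a b) (h' : HasPathOn M T p q) (hST : Disjoint S T) (hS : t ∉ S) (hT : t ∉ T)
    (hun : S ∪ T ∪ {t} = Set.univ) (hab : a ≠ b) (hpq : p ≠ q) (e₁ e₂ : Sym2 V)
    (hB : ∀ r ∈ [s(a, t), s(b, t), s(t, p), s(t, q), s(a, p), s(a, q), s(b, p), s(b, q)],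
      r ∈ B → r = e₁ ∨ r = e₂) :
    WinsFrom (nonDiag V) HasHamiltonianPath M B := by
  refine .step fun e => ?_
  generalize hC : insert e B = C
  have hne : ∀ {x y}, x ∈ S → y ∈ T → x ≠ y := fun hx hy hxy =>
    Set.disjoint_left.1 hST hx (hxy ▸ hy)
  have hap := hne h.left_mem h'.left_mem
  have haq := hne h.left_mem h'.right_mem
  have hbp := hne h.right_mem h'.left_mem
  have hbq := hne h.right_mem h'.right_mem
  have hat : a ≠ t := fun hh => hS (hh ▸ h.left_mem)
  have hbt : b ≠ t := fun hh => hS (hh ▸ h.right_mem)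
  have hpt : p ≠ t := fun hh => hT (hh ▸ h'.left_mem)
  have hqt : q ≠ t := fun hh => hT (hh ▸ h'.right_mem)
  set R := [s(a, t), s(b, t), s(t, p), s(t, q), s(a, p), s(a, q), s(b, p), s(b, q)] with hR
  have hnd : R.Nodup := by
    simp [hR]
    grind
  -- Only `e₁`, `e₂` and the new edge `e` can be Breaker's.
  have hcount : R.countP (· ∈ C) ≤ 3 := by
    rw [List.countP_eq_length_filter]
    refine ((hnd.filter _).subperm (l₂ := [e₁, e₂, e]) fun r hr => ?_).length_le
    have := hB r
    simp only [List.mem_filter, ← hC, Set.mem_insert_iff, decide_eq_true_eq] at hr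
    grind
  have hadd : ∀ f, M ⊆ insert f M := fun f => Set.subset_insert _ _
  have hst : ∀ {M}, HasPathOn M {t} t t := .singleton _ _
  have hSt : Disjoint S {t} := Set.disjoint_singleton_right.2 hS
  have hTt : Disjoint {t} T := Set.disjoint_singleton_left.2 hT
  have hStT : Disjoint (S ∪ {t}) T := hST.union_left hTt
  have hS_tT : Disjoint S ({t} ∪ T) := hSt.union_right hST
  have hun₁ : S ∪ {t} ∪ T = Set.univ := by rw [← hun, Set.union_right_comm]
  have hun₂ : S ∪ ({t} ∪ T) = Set.univ := by rw [← hun₁, Set.union_assoc]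
  have cat := winsFrom_of_two_paths (B := C) (((h.symm).mono (hadd s(a, t))).join hst hSt
    (Set.mem_insert _ _)) (h'.mono (hadd _)) hStT hun₁ hbt hpq
  have cbt := winsFrom_of_two_paths (B := C) ((h.mono (hadd s(b, t))).join hst hSt
    (Set.mem_insert _ _)) (h'.mono (hadd _)) hStT hun₁ hat hpq
  have ctp := winsFrom_of_two_paths (B := C) (h.mono (hadd s(t, p)))
    (hst.join (h'.mono (hadd _)) hTt (Set.mem_insert _ _)) hS_tT hun₂ hab hqt.symm
  have ctq := winsFrom_of_two_paths (B := C) (h.mono (hadd s(t, q)))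
    (hst.join (h'.symm.mono (hadd _)) hTt (Set.mem_insert _ _)) hS_tT hun₂ hab hpt.symm
  have hD : ∀ {x y : V}, x ≠ y → s(x, y) ∈ nonDiag V := fun h => by simpa using h
  have hmem : ∀ f, f ∉ C ↔ (if decide (f ∈ C) = true then 1 else 0) = 0 := by simp
  -- If every attachment of `t` fails, each edge at `t` to an end is Breaker's or leaves at least
  -- three Breaker edges among four joining edges. With at most three Breaker edges among the eight,
  -- counting with 0/1 indicators excludes this.
  by_contra hcon
  have hcon' : ∀ f ∈ nonDiag V,
      WinsFrom (nonDiag V) HasHamiltonianPath (insert f M) (C) →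
      (if decide (f ∈ C) = true then 1 else 0) ≠ 0 := fun f hf hw h0 =>
    hcon ⟨f, hf, (hmem f).2 h0, hw⟩
  have hle : ∀ f, (if decide (f ∈ C) = true then 1 else 0) ≤ 1 := fun f => by split_ifs <;> simp
  have hat' := hle s(a, t)
  have hbt' := hle s(b, t)
  have htp := hle s(t, p)
  have htq := hle s(t, q)
  have nat := fun h => hcon' _ (hD hat) (cat h)
  have nbt := fun h => hcon' _ (hD hbt) (cbt h)
  have ntp := fun h => hcon' _ (hD hpt.symm) (ctp h)
  have ntq := fun h => hcon' _ (hD hqt.symm) (ctq h)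
  simp only [hR, List.countP_cons, List.countP_nil] at hcount nat nbt ntp ntq
  generalize (if decide (s(a, t) ∈ C) = true then 1 else 0) = x₀ at *
  generalize (if decide (s(b, t) ∈ C) = true then 1 else 0) = x₁ at *
  generalize (if decide (s(t, p) ∈ C) = true then 1 else 0) = x₂ at *
  generalize (if decide (s(t, q) ∈ C) = true then 1 else 0) = x₃ at *
  generalize (if decide (s(a, p) ∈ C) = true then 1 else 0) = x₄ at *
  generalize (if decide (s(a, q) ∈ C) = true then 1 else 0) = x₅ at *
  generalize (if decide (s(b, p) ∈ C) = true then 1 else 0) = x₆ at *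
  generalize (if decide (s(b, q) ∈ C) = true then 1 else 0) = x₇ at *
  omega

end

/-! ### Growing the path -/

section

variable {V : Type*} [DecidableEq V]

theorem HasPathOn.extend {M : Set (Sym2 V)} {U : Finset V} {a b z : V}
    (h : HasPathOn M (↑U)ᶜ a b) (hz : z ∈ U) :
    HasPathOn (insert s(a, z) M) (↑(U.erase z))ᶜ z b := by
  have := (HasPathOn.singleton (insert s(a, z) M) z).join (h.mono (Set.subset_insert _ _))
    (by simpa using hz) (by rw [Sym2.eq_swap]; exact Set.mem_insert _ _)
  convert this using 1
  ext v
  simp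
  tauto

/-- Maker owns a path from `a` to `b`, Breaker owns no edge inside the set `U` of remaining vertices,
none from `b` to `U`, and at most one from `a` to `U`. Then Maker wins. -/
theorem winsFrom_of_path (k : ℕ) : ∀ (U : Finset V) (M B : Set (Sym2 V)) (a b y : V),
    U.card = k + 3 → HasPathOn M (↑U)ᶜ a b → a ≠ b → (∀ u ∈ U, ∀ v ∈ U, u ≠ v → s(u, v) ∉ B) →
    (∀ u ∈ U, s(b, u) ∉ B) → (∀ u ∈ U, s(a, u) ∈ B → u = y) →
    WinsFrom (nonDiag V) HasHamiltonianPath M B := by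
  induction k with
  | zero =>
    intro U M B a b y hU h hab hUU hb ha
    refine .step fun e => ?_
    obtain ⟨p, q, t, hpq, hpt, hqt, rfl⟩ := Finset.card_eq_three.1 hU
    have haU : a ∉ ({p, q, t} : Finset V) := by simpa using h.left_mem
    have hbU : b ∉ ({p, q, t} : Finset V) := by simpa using h.right_mem
    have main : ∀ {p q t : V}, p ≠ q → p ≠ t → q ≠ t →
        HasPathOn M (↑({p, q, t} : Finset V))ᶜ a b →
        (∀ u ∈ ({p, q, t} : Finset V), ∀ v ∈ ({p, q, t} : Finset V), u ≠ v → s(u, v) ∉ B) →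
        (∀ u ∈ ({p, q, t} : Finset V), s(b, u) ∉ B) →
        (∀ u ∈ ({p, q, t} : Finset V), s(a, u) ∈ B → u = y) → s(p, q) ≠ e →
        ∃ f ∈ nonDiag V, f ∉ insert e B ∧
          WinsFrom (nonDiag V) HasHamiltonianPath (insert f M) (insert e B) := by
      intro p q t hpq hpt hqt h hUU hb ha he
      refine ⟨s(p, q), by simpa using hpq, ?_, ?_⟩
      · have := hUU p (by simp) q (by simp) hpq
        grind
      · have hpq' := (HasPathOn.singleton (insert s(p, q) M) p).join (.singleton _ q)
          (by simpa using hpq) (Set.mem_insert _ _)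
        refine winsFrom_of_three_paths (t := t) (h.mono (Set.subset_insert _ _)) hpq' ?_ ?_ ?_ ?_
          hab hpq s(a, y) e ?_
        · rw [Set.disjoint_left]
          simp
          tauto
        · simp
        · simp [hpt.symm, hqt.symm]
        · ext v
          simp
          tauto
        · have hno : ∀ r, r ∉ B → r ∈ insert e B → r = s(a, y) ∨ r = e := fun r hr h =>
            .inr (h.resolve_right hr)
          have hay : ∀ u ∈ ({p, q, t} : Finset V), s(a, u) ∈ insert e B →
              s(a, u) = s(a, y) ∨ s(a, u) = e := fun u hu h =>
            h.symm.imp_left fun h => by rw [ha u hu h]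
          simp only [List.forall_mem_cons]
          exact ⟨hay t (by simp), hno _ (hb t (by simp)),
            hno _ (hUU t (by simp) p (by simp) hpt.symm),
            hno _ (hUU t (by simp) q (by simp) hqt.symm), hay p (by simp), hay q (by simp),
            hno _ (hb p (by simp)), hno _ (hb q (by simp)), by simp⟩
    -- If Breaker has just taken `pq`, exchange `q` and `t`: the edge `pt` is free.
    by_cases he : s(p, q) = e
    · have hperm : ({p, q, t} : Finset V) = {p, t, q} := by ext; simp; tauto
      rw [hperm] at h hUU hb ha
      exact main hpt hpq hqt.symm h hUU hb ha (by rw [← he]; simp; grind)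
    · exact main hpq hpt hqt h hUU hb ha he
  | succ k ih =>
    intro U M B a b y hU h hab hUU hb ha
    refine .step fun e => ?_
    have haU : a ∉ U := by simpa using h.left_mem
    have hbU : b ∉ U := by simpa using h.right_mem
    -- If Breaker plays `pq` inside `U`, absorbing `p` at the end `a` removes that edge from `U`;
    -- the new end `p` has at most the Breaker edge to `q`. The edge `ap` is free because `p ≠ y`.
    by_cases he : ∃ p ∈ U, ∃ q ∈ U, p ≠ y ∧ e = s(p, q)
    · obtain ⟨p, hp, q, hq, hpy, rfl⟩ := he
      have hap : s(a, p) ≠ s(p, q) := by simp; grind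
      refine ⟨s(a, p), by simp; grind, by grind,
        ih (U.erase p) _ _ p b q (by rw [Finset.card_erase_of_mem hp]; omega) (h.extend hp)
          (by grind) ?_ ?_ ?_⟩
      · intro u hu v hv huv
        have := hUU u (Finset.mem_of_mem_erase hu) v (Finset.mem_of_mem_erase hv) huv
        simp only [Finset.mem_erase] at hu hv
        simp only [Set.mem_insert_iff, Sym2.eq_iff]
        grind
      · intro u hu
        have := hb u (Finset.mem_of_mem_erase hu)
        simp only [Set.mem_insert_iff, Sym2.eq_iff]
        grind
      · intro u hu
        have := hUU p hp u (Finset.mem_of_mem_erase hu) (Finset.ne_of_mem_erase hu).symm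
        simp only [Set.mem_insert_iff, Sym2.eq_iff]
        grind
    -- Otherwise `e` meets `U` in at most one vertex `t` from outside. Extending `a` to `z ∉ {y, t}`
    -- makes `z` the clean end, while `b` takes over the role of the end with at most one Breaker
    -- edge, to `t`.
    · obtain ⟨t, ht⟩ : ∃ t, ∀ u ∈ U, ∀ v, v ∉ U → e = s(v, u) → u = t := by
        by_cases ht : ∃ t ∈ U, ∃ v, v ∉ U ∧ e = s(v, t)
        · obtain ⟨t, ht, v, hv, rfl⟩ := ht
          refine ⟨t, fun u hu w hw huw => ?_⟩
          rw [Sym2.eq_iff] at huw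
          grind
        · exact ⟨y, fun u hu v hv huv => absurd ⟨u, hu, v, hv, huv⟩ ht⟩
      have heU : ∀ u ∈ U, ∀ v ∈ U, u ≠ v → e ≠ s(u, v) := by
        intro u hu v hv huv heq
        by_cases huy : u = y
        · exact he ⟨v, hv, u, hu, by grind, by rw [heq, Sym2.eq_swap]⟩
        · exact he ⟨u, hu, v, hv, huy, heq⟩
      obtain ⟨z, hz⟩ : ((U.erase y).erase t).Nonempty := by
        rw [← Finset.card_pos]
        have h₁ := Finset.pred_card_le_card_erase (s := U) (a := y)
        have h₂ := Finset.pred_card_le_card_erase (s := U.erase y) (a := t)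
        omega
      simp only [Finset.mem_erase] at hz
      obtain ⟨hzt, hzy, hz⟩ := hz
      have hbz : b ≠ z := fun hh => hbU (hh ▸ hz)
      refine ⟨s(a, z), by simp; grind, ?_, ih (U.erase z) _ _ b z t
        (by rw [Finset.card_erase_of_mem hz]; omega) (h.extend hz).symm hbz ?_ ?_ ?_⟩
      · rintro (hh | hh)
        · exact hzt (ht z hz a haU hh.symm)
        · exact hzy (ha z hz hh)
      · rintro u hu v hv huv (hh | hh)
        · exact heU u (Finset.mem_of_mem_erase hu) v (Finset.mem_of_mem_erase hv) huv hh.symm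
        · exact hUU u (Finset.mem_of_mem_erase hu) v (Finset.mem_of_mem_erase hv) huv hh
      · rintro u hu (hh | hh)
        · exact heU z hz u (Finset.mem_of_mem_erase hu) (Finset.ne_of_mem_erase hu).symm hh.symm
        · exact hUU z hz u (Finset.mem_of_mem_erase hu) (Finset.ne_of_mem_erase hu).symm hh
      · rintro u hu (hh | hh)
        · exact ht u (Finset.mem_of_mem_erase hu) b hbU hh.symm
        · exact absurd hh (hb u (Finset.mem_of_mem_erase hu))

/-- Maker answers `xy` with an edge `xz`: this path has Breaker's edge only at the end `x`, towards
`y`, and at least three vertices are missing. -/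
theorem winsFrom_empty [Fintype V] (hV : 5 ≤ Fintype.card V) :
    WinsFrom (nonDiag V) HasHamiltonianPath (∅ : Set (Sym2 V)) ∅ := by
  refine .step fun e => ?_
  induction e with | _ x y
  obtain ⟨z, hz⟩ : ∃ z, z ∉ ({x, y} : Finset V) := by
    by_contra! hall
    have := Finset.card_le_card (show Finset.univ ⊆ ({x, y} : Finset V) from fun z _ => hall z)
    have := Finset.card_le_two (a := x) (b := y)
    rw [Finset.card_univ] at *
    omega
  have hxz : x ≠ z := by rintro rfl; simp at hz
  have hyz : y ≠ z := by rintro rfl; simp at hz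
  refine ⟨s(x, z), by simpa using hxz, by simp; grind,
    winsFrom_of_path (Fintype.card V - 5) ({x, z}ᶜ) _ _ x z y ?_ ?_ hxz ?_ ?_ ?_⟩
  · rw [Finset.card_compl, Finset.card_pair hxz]
    omega
  · have := (HasPathOn.singleton (insert s(x, z) ∅) x).join (.singleton _ z)
      (by simpa using hxz) (Set.mem_insert _ _)
    convert this using 1
    ext v
    simp
    tauto
  all_goals
    simp only [Set.mem_insert_iff, Set.mem_empty_iff_false, Finset.mem_compl, Finset.mem_insert,
      Finset.mem_singleton, Sym2.eq_iff]
    grind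

end

/-! ### Translation to walks and conclusion -/

/-- The edges of a Hamiltonian path form a winning set of the Hamiltonian path game. -/
theorem exists_winningSet_subset {n : ℕ}
    (N : Set (SimpleGraph.completeGraph (Fin n)).edgeSet)
    (h : HasHamiltonianPath (Subtype.val '' N)) :
    ∃ F ∈ (hamiltonianPathGame n).winningSets, F ⊆ N := by
  obtain ⟨a, b, l, hnd, hch, hmem, ha, -⟩ := h
  have hl : l ≠ [] := by rintro rfl; simp at ha
  let G := SimpleGraph.fromEdgeSet (Subtype.val '' N)
  have hG : G ≤ SimpleGraph.completeGraph (Fin n) := le_top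
  have hch' : l.IsChain G.Adj := hch.imp fun u v huv => by
    refine (SimpleGraph.fromEdgeSet_adj _).2 ⟨huv, ?_⟩
    obtain ⟨⟨e, he⟩, -, rfl⟩ := huv
    exact ((SimpleGraph.mem_edgeSet _).1 he).ne
  let w := SimpleGraph.Walk.ofSupport l hl hch'
  have hw : w.support = l := SimpleGraph.Walk.support_ofSupport hl hch'
  have hedge : ∀ e ∈ w.edges, e ∈ Subtype.val '' N := fun e he => by
    have := w.edges_subset_edgeSet he
    rw [SimpleGraph.edgeSet_fromEdgeSet] at this
    exact this.1
  refine ⟨{e | e.1 ∈ w.edges}, ⟨_, _, w.mapLe hG, ?_, ?_⟩, ?_⟩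
  · intro v
    rw [SimpleGraph.Walk.support_mapLe_eq_support, hw]
    exact List.count_eq_one_of_mem hnd ((hmem v).2 (Set.mem_univ v))
  · rw [SimpleGraph.Walk.edges_mapLe_eq_edges]
    ext e
    constructor
    · rintro ⟨x, hx, rfl⟩
      exact hx
    · intro he
      exact ⟨⟨e, by obtain ⟨x, -, rfl⟩ := hedge e he; exact x.2⟩, he, rfl⟩
  · intro e he
    obtain ⟨x, hx, hxe⟩ := hedge _ he
    rwa [← Subtype.ext hxe]

theorem makerWins_hamiltonianPathGame {n : ℕ} (hn : 5 ≤ n) (s : Seat) :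
    MakerWins (hamiltonianPathGame n) s := by
  have : NeZero n := ⟨by omega⟩
  have : Inhabited (Sym2 (Fin n)) := ⟨s(0, 0)⟩
  have hD : nonDiag (Fin n) = (SimpleGraph.completeGraph (Fin n)).edgeSet := by
    ext e
    induction e with | _ x y
    simp
  refine makerWins_of_winsFrom _ HasHamiltonianPath.mono exists_winningSet_subset ?_ s
  rw [← hD]
  exact winsFrom_empty (by simpa using hn)

end MakerBreaker

theorem theorem2 (n : ℕ) (hn : 4 ≤ n) :
    (MakerBreaker.MakerWins (MakerBreaker.hamiltonianPathGame n) MakerBreaker.Seat.first ↔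
      5 ≤ n) ∧
    (MakerBreaker.MakerWins (MakerBreaker.hamiltonianPathGame n) MakerBreaker.Seat.second ↔
      5 ≤ n) := by
  have key : ∀ s, MakerBreaker.MakerWins (MakerBreaker.hamiltonianPathGame n) s ↔ 5 ≤ n := by
    refine fun s => ⟨fun h => ?_, fun h => MakerBreaker.makerWins_hamiltonianPathGame h s⟩
    by_contra hlt
    obtain rfl : n = 4 := by omega
    exact MakerBreaker.not_makerWins_hamiltonianPathGame_four s h
  exact ⟨key _, key _⟩
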